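/- Let $K$ be a compact Hausdorff space, let $C(K)$ be the real Banach space of continuous functions $K\to\mathbb{R}$ with the maximum norm, and let $Y$ be a real Banach space. Write $S_X$ for the unit sphere of a normed space $X$. Let $T:S_{C(K)}\to S_Y$ be a surjective phase-isometry, that is, a surjective map such that $$\{\|T(f)+T(g)\|,\ \|T(f)-T(g)\|\}=\{\|f+g\|,\ \|f-g\|\}\qquad\text{for all } f,g\in S_{C(K)}.$$ Then $T$ is phase-equivalent to an isometry which can be extended to a linear isometry from $C(K)$ onto $Y$. That is, there are a (not necessarily continuous) function $\varepsilon:S_{C(K)}\to\{-1,1\}$ and a surjective real-linear isometry $U:C(K)\to Y$ such that $\varepsilon\cdot T:S_{C(K)}\to S_Y$ is an isometry and $U(f)=\varepsilon(f)\,T(f)$ for all $f\in S_{C(K)}$. -/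

import Mathlib

/-- A map `T : A → B` between subsets of real normed spaces is a phase-isometry if
`{‖T x + T y‖, ‖T x - T y‖} = {‖x + y‖, ‖x - y‖}` (equality of sets) for all `x, y ∈ A`. -/
def IsPhaseIsometry {X Y : Type*} [NormedAddCommGroup X] [NormedSpace ℝ X]
    [NormedAddCommGroup Y] [NormedSpace ℝ Y] {A : Set X} {B : Set Y} (T : A → B) : Prop :=
  ∀ x y : A,
    ({‖(T x : Y) + (T y : Y)‖, ‖(T x : Y) - (T y : Y)‖} : Set ℝ) =
      {‖(x : X) + (y : X)‖, ‖(x : X) - (y : X)‖}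

/-- Two maps `S, T : A → B` are phase-equivalent if `ε · T = S` for some (not necessarily
continuous) phase function `ε : A → {-1, 1}`. -/
def PhaseEquivalent {X Y : Type*} [NormedAddCommGroup X] [NormedSpace ℝ X]
    [NormedAddCommGroup Y] [NormedSpace ℝ Y] {A : Set X} {B : Set Y} (S T : A → B) : Prop :=
  ∃ ε : A → ℝ, (∀ x, ε x = -1 ∨ ε x = 1) ∧ ∀ x, ε x • (T x : Y) = (S x : Y)

/-!
The map `T` respects alignment up to sign: if `‖p + x‖ = 2` in the sphere of `C(K)`, then
`‖T p + T x‖ = 2` or `‖T p - T x‖ = 2`, and conversely. Fix `t : K`. If `p` is an average of finitely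
many norm-one functions `fᵢ` with `fᵢ t = 1`, then everything aligned with `p` is aligned with every
`fᵢ`. As `T` is onto, this passes to `Y`, and averaging there too produces a functional in the
unit ball of `Y*` that has modulus one at all the `T fᵢ` (`exists_dual_abs_eq_one_of_finset`).
Weak-star compactness makes this uniform over all `f` with `f t = 1`. Testing against suitable
functions that equal one at `t` upgrades it to `φ_t (T f) = ± f t` for every `f`, that is, to a
functional `φ_t` with `|φ_t (T f)| = |f t|` (`exists_dual_abs_eq`).

Choose the sign of each `φ_t` so that `φ_t (T 1) = 1`, and put `Φ y = (t ↦ φ_t y)`. Every `y` is a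
multiple of some `T f`, so `|Φ y|` is continuous and has supremum `‖y‖`. Since
`Φ y + M = |Φ (y + M • T 1)|` for large `M`, the function `Φ y` is itself continuous, and `Φ` is a
linear isometry from `Y` into `C(K)` (`exists_linearIsometry`). It remains to see that
`Φ (T f) = f` or `Φ (T f) = -f`, with one sign valid on all of `K`. For `f ≥ 0` a change of sign is
excluded by comparing `T f` with `T 1`; for general `f`, by comparing it with `T g` for
nonnegative `g` such as `1 + min f 0` (`eq_or_eq_neg_of_forall_nonneg`). In particular `Φ` is onto,
and `Φ⁻¹` is the required linear isometry.
-/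

/-! ### Phase-isometries -/

theorem IsPhaseIsometry.norm_eq_or {X Y : Type*} [NormedAddCommGroup X] [NormedSpace ℝ X]
    [NormedAddCommGroup Y] [NormedSpace ℝ Y] {A : Set X} {B : Set Y} {T : A → B}
    (hT : IsPhaseIsometry T) (x y : A) :
    (‖(T x : Y) + T y‖ = ‖(x : X) + y‖ ∧ ‖(T x : Y) - T y‖ = ‖(x : X) - y‖) ∨
      (‖(T x : Y) + T y‖ = ‖(x : X) - y‖ ∧ ‖(T x : Y) - T y‖ = ‖(x : X) + y‖) :=
  Set.pair_eq_pair_iff.1 (hT x y)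

/-! ### Norm-one functions on a compact space -/

section Functions

variable {K : Type*} [TopologicalSpace K] [CompactSpace K]

theorem ContinuousMap.exists_abs_apply_eq_norm [Nonempty K] (f : C(K, ℝ)) :
    ∃ s, |f s| = ‖f‖ := by
  obtain ⟨s, -, hs⟩ := isCompact_univ.exists_isMaxOn (s := (Set.univ : Set K))
    Set.univ_nonempty (f := fun x => |f x|) (by fun_prop)
  refine ⟨s, le_antisymm (f.norm_coe_le_norm s) ?_⟩
  exact (ContinuousMap.norm_le f (abs_nonneg _)).2 fun x => hs (Set.mem_univ x)

theorem ContinuousMap.norm_eq_one_of_apply_eq_one {g : C(K, ℝ)} {t : K}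
    (h : ∀ x, |g x| ≤ 1) (ht : g t = 1) : ‖g‖ = 1 := by
  refine le_antisymm ((ContinuousMap.norm_le g zero_le_one).2 h) ?_
  simpa [ht] using g.norm_coe_le_norm t

theorem abs_coe_sphere_apply_le_one (f : Metric.sphere (0 : C(K, ℝ)) 1) (x : K) :
    |(f : C(K, ℝ)) x| ≤ 1 := by
  simpa [norm_eq_of_mem_sphere f] using (f : C(K, ℝ)).norm_coe_le_norm x

/-- The witness is an average of `f₀` and the members of `F` with positive weights. -/
theorem exists_sphere_forall_apply_eq {t : K} (f₀ : Metric.sphere (0 : C(K, ℝ)) 1)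
    (h₀ : (f₀ : C(K, ℝ)) t = 1)
    (F : Finset {f : Metric.sphere (0 : C(K, ℝ)) 1 // (f : C(K, ℝ)) t = 1}) :
    ∃ p : Metric.sphere (0 : C(K, ℝ)) 1, (p : C(K, ℝ)) t = 1 ∧
      ∀ s, |(p : C(K, ℝ)) s| = 1 → ∀ f ∈ F, (f.1 : C(K, ℝ)) s = (p : C(K, ℝ)) s := by
  classical
  induction F using Finset.induction_on with
  | empty => exact ⟨f₀, h₀, by simp⟩
  | insert f F _ ih =>
    obtain ⟨p, hpt, hp⟩ := ih
    have hq : ∀ s, ((1 / 2 : ℝ) • ((p : C(K, ℝ)) + (f.1 : C(K, ℝ)))) s =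
        ((p : C(K, ℝ)) s + (f.1 : C(K, ℝ)) s) / 2 := fun s => by
      simp only [ContinuousMap.smul_apply, ContinuousMap.add_apply, smul_eq_mul]; ring
    have hqt : ((1 / 2 : ℝ) • ((p : C(K, ℝ)) + (f.1 : C(K, ℝ)))) t = 1 := by
      rw [hq, hpt, f.2]; norm_num
    refine ⟨⟨(1 / 2 : ℝ) • ((p : C(K, ℝ)) + (f.1 : C(K, ℝ))), mem_sphere_zero_iff_norm.2
      (ContinuousMap.norm_eq_one_of_apply_eq_one (fun s => ?_) hqt)⟩, hqt, fun s hs => ?_⟩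
    · have h1 := abs_le.1 (abs_coe_sphere_apply_le_one p s)
      have h2 := abs_le.1 (abs_coe_sphere_apply_le_one f.1 s)
      rw [hq, abs_le]; constructor <;> linarith
    · have h1 := abs_le.1 (abs_coe_sphere_apply_le_one p s)
      have h2 := abs_le.1 (abs_coe_sphere_apply_le_one f.1 s)
      simp only [hq] at hs ⊢
      -- The average of two numbers in `[-1, 1]` is extreme only if both are, with the same sign.
      have key : (f.1 : C(K, ℝ)) s = (p : C(K, ℝ)) s ∧ |(p : C(K, ℝ)) s| = 1 := by
        rcases eq_or_eq_neg_of_abs_eq hs with h | h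
        · have h3 : (p : C(K, ℝ)) s = 1 := by linarith
          exact ⟨by linarith, by simp [h3]⟩
        · have h3 : (p : C(K, ℝ)) s = -1 := by linarith
          exact ⟨by linarith, by simp [h3]⟩
      intro g hg
      rcases Finset.mem_insert.1 hg with rfl | hg
      · linarith [key.1]
      · linarith [key.1, hp s key.2 g hg]

theorem exists_apply_eq_one_norm_add_le_norm_sub_le (f : Metric.sphere (0 : C(K, ℝ)) 1) (t : K) :
    ∃ g : Metric.sphere (0 : C(K, ℝ)) 1, (g : C(K, ℝ)) t = 1 ∧
      ‖(f : C(K, ℝ)) + g‖ ≤ 1 + |(f : C(K, ℝ)) t| ∧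
      ‖(f : C(K, ℝ)) - g‖ ≤ 1 + |(f : C(K, ℝ)) t| := by
  -- Where `|f|` exceeds `|f t|`, this function has dropped from `1` by at least the excess.
  let G : C(K, ℝ) :=
    ⟨fun x => max 0 (1 - |(f : C(K, ℝ)) x - (f : C(K, ℝ)) t|), by fun_prop⟩
  have hG : ∀ x, G x = max 0 (1 - |(f : C(K, ℝ)) x - (f : C(K, ℝ)) t|) := fun _ => rfl
  have hGt : G t = 1 := by simp [hG]
  have hbound : ∀ x, 0 ≤ G x ∧ G x ≤ 1 := fun x => by
    rw [hG]
    exact ⟨le_max_left _ _, max_le zero_le_one (by linarith [abs_nonneg ((f : C(K, ℝ)) x -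
      (f : C(K, ℝ)) t)])⟩
  have hfG : ∀ x, |(f : C(K, ℝ)) x| + G x ≤ 1 + |(f : C(K, ℝ)) t| := fun x => by
    have h1 := abs_coe_sphere_apply_le_one f x
    have h2 := abs_sub_abs_le_abs_sub ((f : C(K, ℝ)) x) ((f : C(K, ℝ)) t)
    have h3 := abs_nonneg ((f : C(K, ℝ)) t)
    rw [hG]
    rcases max_choice 0 (1 - |(f : C(K, ℝ)) x - (f : C(K, ℝ)) t|) with h | h <;> rw [h] <;>
      linarith
  refine ⟨⟨G, mem_sphere_zero_iff_norm.2
    (ContinuousMap.norm_eq_one_of_apply_eq_one (fun x => ?_) hGt)⟩, hGt, ?_, ?_⟩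
  · rw [abs_of_nonneg (hbound x).1]; exact (hbound x).2
  · refine (ContinuousMap.norm_le _ (by positivity)).2 fun x => ?_
    have := abs_add_le ((f : C(K, ℝ)) x) (G x)
    rw [abs_of_nonneg (hbound x).1] at this
    exact this.trans (hfG x)
  · refine (ContinuousMap.norm_le _ (by positivity)).2 fun x => ?_
    have := abs_sub ((f : C(K, ℝ)) x) (G x)
    rw [abs_of_nonneg (hbound x).1] at this
    exact this.trans (hfG x)

theorem exists_apply_eq_one_norm_sub_le (f : C(K, ℝ)) (hf : ‖f‖ = 1) (t : K) :
    ∃ g : Metric.sphere (0 : C(K, ℝ)) 1, (g : C(K, ℝ)) t = 1 ∧ ‖f - g‖ ≤ 1 - f t := by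
  have hle : ∀ x, |f x| ≤ 1 := fun x => hf ▸ f.norm_coe_le_norm x
  have ht1 : f t ≤ 1 := (abs_le.1 (hle t)).2
  let G : C(K, ℝ) := ⟨fun x => min 1 (f x + (1 - f t)), by fun_prop⟩
  have hG : ∀ x, G x = min 1 (f x + (1 - f t)) := fun _ => rfl
  have hGt : G t = 1 := by simp [hG]
  refine ⟨⟨G, mem_sphere_zero_iff_norm.2
    (ContinuousMap.norm_eq_one_of_apply_eq_one (fun x => ?_) hGt)⟩, hGt, ?_⟩
  · rw [hG, abs_le]
    exact ⟨le_min (by norm_num) (by linarith [(abs_le.1 (hle x)).1]), min_le_left _ _⟩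
  · refine (ContinuousMap.norm_le _ (by linarith)).2 fun x => ?_
    change |f x - G x| ≤ 1 - f t
    have h1 := (abs_le.1 (hle x)).2
    rw [hG, abs_le]
    rcases min_choice 1 (f x + (1 - f t)) with h | h
    · have := min_le_right 1 (f x + (1 - f t))
      rw [h] at this ⊢
      constructor <;> linarith
    · rw [h]; constructor <;> linarith

theorem exists_apply_eq_one_norm_sub_le_or_norm_add_le (f : Metric.sphere (0 : C(K, ℝ)) 1)
    (t : K) :
    ∃ g : Metric.sphere (0 : C(K, ℝ)) 1, (g : C(K, ℝ)) t = 1 ∧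
      (‖(f : C(K, ℝ)) - g‖ ≤ 1 - |(f : C(K, ℝ)) t| ∨
        ‖(f : C(K, ℝ)) + g‖ ≤ 1 - |(f : C(K, ℝ)) t|) := by
  rcases le_total 0 ((f : C(K, ℝ)) t) with ht | ht
  · obtain ⟨g, hg, h⟩ := exists_apply_eq_one_norm_sub_le (f : C(K, ℝ))
      (norm_eq_of_mem_sphere f) t
    exact ⟨g, hg, Or.inl (by rwa [abs_of_nonneg ht])⟩
  · obtain ⟨g, hg, h⟩ := exists_apply_eq_one_norm_sub_le (-(f : C(K, ℝ)))
      (by rw [norm_neg, norm_eq_of_mem_sphere f]) t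
    refine ⟨g, hg, Or.inr ?_⟩
    rw [← norm_neg, neg_add', abs_of_nonpos ht]
    simpa using h

/-- The test function is `g = 1 + min f 0`: it satisfies `‖f - g‖ ≤ 1`, whereas `h - g` is less
than `-1` at `t` and `h + g` exceeds `1` at `s`. -/
theorem false_of_forall_nonneg_norm_eq_or {f h : C(K, ℝ)} (hf : ‖f‖ ≤ 1)
    (H : ∀ g : C(K, ℝ), 0 ≤ g → ‖g‖ = 1 → ‖h - g‖ = ‖f - g‖ ∨ ‖h + g‖ = ‖f - g‖)
    {s t : K} (hs : 0 < f s) (hsh : 0 < h s) (ht : 0 < f t) (hth : h t < 0) : False := by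
  have hle : ∀ x, |f x| ≤ 1 := fun x => (f.norm_coe_le_norm x).trans hf
  let g : C(K, ℝ) := ⟨fun x => 1 + min (f x) 0, by fun_prop⟩
  have hg : ∀ x, g x = 1 + min (f x) 0 := fun _ => rfl
  have hgs : g s = 1 := by rw [hg, min_eq_right hs.le, add_zero]
  have hgt : g t = 1 := by rw [hg, min_eq_right ht.le, add_zero]
  have hg0 : ∀ x, 0 ≤ g x := fun x => by
    have := le_min (abs_le.1 (hle x)).1 (by norm_num : (-1 : ℝ) ≤ 0)
    rw [hg]; linarith
  have hg1 : ‖g‖ = 1 := ContinuousMap.norm_eq_one_of_apply_eq_one (fun x => by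
    rw [abs_of_nonneg (hg0 x), hg]; linarith [min_le_right (f x) 0]) hgs
  have hfg : ‖f - g‖ ≤ 1 := (ContinuousMap.norm_le _ zero_le_one).2 fun x => by
    change |f x - g x| ≤ 1
    have h1 := (abs_le.1 (hle x)).2
    rw [hg, abs_le]
    rcases le_total (f x) 0 with h | h
    · rw [min_eq_left h]; constructor <;> linarith
    · rw [min_eq_right h]; constructor <;> linarith
  rcases H g hg0 hg1 with h' | h'
  · have := (h - g).neg_norm_le_apply t
    rw [ContinuousMap.sub_apply, hgt] at this
    linarith
  · have := (h + g).apply_le_norm s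
    rw [ContinuousMap.add_apply, hgs] at this
    linarith

/-- Functions of equal modulus that are indistinguishable, in the phase-isometric sense, by
nonnegative test functions agree up to one global sign. -/
theorem eq_or_eq_neg_of_forall_nonneg {f h : C(K, ℝ)} (hf : ‖f‖ = 1)
    (habs : ∀ x, |h x| = |f x|)
    (H : ∀ g : C(K, ℝ), 0 ≤ g → ‖g‖ = 1 →
      (‖h + g‖ = ‖f + g‖ ∧ ‖h - g‖ = ‖f - g‖) ∨ (‖h + g‖ = ‖f - g‖ ∧ ‖h - g‖ = ‖f + g‖)) :
    h = f ∨ h = -f := by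
  by_contra hne
  rw [not_or, ContinuousMap.ext_iff, ContinuousMap.ext_iff, not_forall, not_forall] at hne
  obtain ⟨⟨t, ht⟩, s, hs⟩ := hne
  have ht' : h t = -f t := (abs_eq_abs.1 (habs t)).resolve_left ht
  have hs' : h s = f s := (abs_eq_abs.1 (habs s)).resolve_right hs
  have hft : f t ≠ 0 := fun h0 => ht (by rw [ht', h0, neg_zero])
  have hfs : f s ≠ 0 := fun h0 => hs (by simp [hs', h0])
  have hh : ‖h‖ ≤ 1 := (ContinuousMap.norm_le h zero_le_one).2 fun x => by
    rw [Real.norm_eq_abs, habs, ← hf]; exact f.norm_coe_le_norm x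
  have norm_neg_sub (u g : C(K, ℝ)) : ‖-u - g‖ = ‖u + g‖ := by rw [← neg_add', norm_neg]
  have norm_neg_add (u g : C(K, ℝ)) : ‖-u + g‖ = ‖u - g‖ := by rw [← norm_neg]; congr 1; abel
  rcases lt_or_gt_of_ne hfs with hs0 | hs0 <;> rcases lt_or_gt_of_ne hft with ht0 | ht0
  · refine false_of_forall_nonneg_norm_eq_or (f := -f) (h := -h) (s := s) (t := t)
      (by rw [norm_neg, hf]) (fun g hg hg1 => ?_) ?_ ?_ ?_ ?_
    · rw [norm_neg_sub, norm_neg_sub, norm_neg_add]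
      rcases H g hg hg1 with h' | h'
      exacts [Or.inl h'.1, Or.inr h'.2]
    all_goals simp only [ContinuousMap.neg_apply]; linarith
  · refine false_of_forall_nonneg_norm_eq_or (f := -h) (h := -f) (s := s) (t := t)
      (by rwa [norm_neg]) (fun g hg hg1 => ?_) ?_ ?_ ?_ ?_
    · rw [norm_neg_sub, norm_neg_sub, norm_neg_add]
      rcases H g hg hg1 with h' | h'
      exacts [Or.inl h'.1.symm, Or.inr h'.1.symm]
    all_goals simp only [ContinuousMap.neg_apply]; linarith
  · refine false_of_forall_nonneg_norm_eq_or (f := h) (h := f) (s := s) (t := t)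
      hh (fun g hg hg1 => ?_) ?_ ?_ ?_ ?_
    · rcases H g hg hg1 with h' | h'
      exacts [Or.inl h'.2.symm, Or.inr h'.2.symm]
    all_goals linarith
  · refine false_of_forall_nonneg_norm_eq_or (f := f) (h := h) (s := s) (t := t)
      hf.le (fun g hg hg1 => ?_) ?_ ?_ ?_ ?_
    · rcases H g hg hg1 with h' | h'
      exacts [Or.inl h'.2, Or.inr h'.1]
    all_goals linarith

end Functions

/-! ### Functionals attached to points -/

section Functionals

variable {K Y : Type*} [TopologicalSpace K] [CompactSpace K] [NormedAddCommGroup Y]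
  [NormedSpace ℝ Y] {T : Metric.sphere (0 : C(K, ℝ)) 1 → Metric.sphere (0 : Y) 1}

theorem apply_le_one_of_mem_sphere {φ : StrongDual ℝ Y} (hφ : ‖φ‖ ≤ 1)
    (y : Metric.sphere (0 : Y) 1) : φ y ≤ 1 := by
  have := φ.le_of_opNorm_le hφ (y : Y)
  rw [norm_eq_of_mem_sphere y] at this
  linarith [(abs_le.1 this).2]

theorem abs_le_norm_of_norm_le_one {φ : StrongDual ℝ Y} (hφ : ‖φ‖ ≤ 1) (y : Y) :
    |φ y| ≤ ‖y‖ := by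
  simpa using φ.le_of_opNorm_le hφ y

/-- In `C(K)`, `‖p + x‖ = 2` means that `p` and `x` take the same value `±1` at some point. -/
theorem norm_add_eq_two_of_norm_add_eq_two {p x f : Metric.sphere (0 : C(K, ℝ)) 1} [Nonempty K]
    (hp : ∀ s, |(p : C(K, ℝ)) s| = 1 → (f : C(K, ℝ)) s = (p : C(K, ℝ)) s)
    (h : ‖(p : C(K, ℝ)) + x‖ = 2) : ‖(f : C(K, ℝ)) + x‖ = 2 := by
  obtain ⟨s, hs⟩ := ((p : C(K, ℝ)) + x).exists_abs_apply_eq_norm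
  rw [h, ContinuousMap.add_apply] at hs
  have h1 := abs_coe_sphere_apply_le_one p s
  have h2 := abs_coe_sphere_apply_le_one x s
  have h3 := abs_add_le ((p : C(K, ℝ)) s) ((x : C(K, ℝ)) s)
  refine le_antisymm ?_ ?_
  · refine (norm_add_le _ _).trans ?_
    rw [norm_eq_of_mem_sphere f, norm_eq_of_mem_sphere x]; norm_num
  · have := ((f : C(K, ℝ)) + x).norm_coe_le_norm s
    rwa [ContinuousMap.add_apply, hp s (by linarith), Real.norm_eq_abs, hs] at this

theorem norm_sub_eq_two_of_norm_sub_eq_two {p x f : Metric.sphere (0 : C(K, ℝ)) 1} [Nonempty K]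
    (hp : ∀ s, |(p : C(K, ℝ)) s| = 1 → (f : C(K, ℝ)) s = (p : C(K, ℝ)) s)
    (h : ‖(p : C(K, ℝ)) - x‖ = 2) : ‖(f : C(K, ℝ)) - x‖ = 2 := by
  have := norm_add_eq_two_of_norm_add_eq_two (x := -x) hp (by simpa [← sub_eq_add_neg] using h)
  simpa [← sub_eq_add_neg] using this

/-- The set of functionals of norm at most one that support `y` shrinks as further vectors are averaged into `y`;
surjectivity of `T` shows that `y` stays aligned, up to sign, with the next `T f`. -/
theorem exists_sphere_forall_dual_abs_eq_one (hT : IsPhaseIsometry T)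
    (hsurj : Function.Surjective T) {t : K} {p : Metric.sphere (0 : C(K, ℝ)) 1}
    (F : Finset {f : Metric.sphere (0 : C(K, ℝ)) 1 // (f : C(K, ℝ)) t = 1})
    (hp : ∀ s, |(p : C(K, ℝ)) s| = 1 → ∀ f ∈ F, (f.1 : C(K, ℝ)) s = (p : C(K, ℝ)) s) :
    ∃ y : Metric.sphere (0 : Y) 1, ∀ ψ : StrongDual ℝ Y, ‖ψ‖ ≤ 1 → ψ y = 1 →
      ψ (T p) = 1 ∧ ∀ f ∈ F, |ψ (T f.1)| = 1 := by
  classical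
  have : Nonempty K := ⟨t⟩
  induction F using Finset.induction_on with
  | empty => exact ⟨T p, fun ψ _ h => ⟨h, by simp⟩⟩
  | insert f F _ ih =>
    obtain ⟨y, hy⟩ := ih fun s hs g hg => hp s hs g (Finset.mem_insert_of_mem hg)
    have hpf := fun s hs => hp s hs f (Finset.mem_insert_self f F)
    obtain ⟨x, rfl⟩ := hsurj y
    have hadd : ‖(T p : Y) + T x‖ = 2 := by
      obtain ⟨ψ, hψ, hψx⟩ := exists_dual_vector'' ℝ (T x : Y)
      have hψx' : ψ (T x) = 1 := by simpa using hψx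
      refine le_antisymm ((norm_add_le _ _).trans ?_) ?_
      · rw [norm_eq_of_mem_sphere (T p), norm_eq_of_mem_sphere (T x)]; norm_num
      · have := (le_abs_self _).trans (abs_le_norm_of_norm_le_one hψ ((T p : Y) + T x))
        rw [map_add, (hy ψ hψ hψx').1, hψx'] at this
        linarith
    have hfx : ‖(T f.1 : Y) + T x‖ = 2 ∨ ‖(T f.1 : Y) - T x‖ = 2 := by
      have h2 : ‖((f.1 : C(K, ℝ))) + x‖ = 2 ∨ ‖((f.1 : C(K, ℝ))) - x‖ = 2 := by
        rcases hT.norm_eq_or p x with h | h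
        · exact Or.inl (norm_add_eq_two_of_norm_add_eq_two hpf (h.1 ▸ hadd))
        · exact Or.inr (norm_sub_eq_two_of_norm_sub_eq_two hpf (h.1 ▸ hadd))
      rcases hT.norm_eq_or f.1 x with h | h <;> rcases h2 with h2 | h2
      exacts [Or.inl (h.1.trans h2), Or.inr (h.2.trans h2), Or.inr (h.2.trans h2),
        Or.inl (h.1.trans h2)]
    obtain ⟨z, hz, hzx⟩ : ∃ z : Metric.sphere (0 : Y) 1,
        ((z : Y) = T f.1 ∨ (z : Y) = -(T f.1 : Y)) ∧ ‖(z : Y) + T x‖ = 2 := by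
      rcases hfx with h | h
      · exact ⟨T f.1, Or.inl rfl, h⟩
      · refine ⟨-T f.1, Or.inr rfl, ?_⟩
        rw [← h, coe_neg_sphere, ← norm_neg]; congr 1; abel
    refine ⟨⟨(1 / 2 : ℝ) • ((z : Y) + T x), mem_sphere_zero_iff_norm.2 ?_⟩,
      fun ψ hψ h => ?_⟩
    · rw [norm_smul, hzx]; norm_num
    · have h' : (1 / 2 : ℝ) * (ψ z + ψ (T x)) = 1 := by
        rwa [map_smul, map_add, smul_eq_mul] at h
      have h1 := apply_le_one_of_mem_sphere hψ z
      have h2 := apply_le_one_of_mem_sphere hψ (T x)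
      have h3 := hy ψ hψ (by linarith)
      have h4 : ψ z = 1 := by linarith
      refine ⟨h3.1, fun g hg => ?_⟩
      rcases Finset.mem_insert.1 hg with rfl | hg
      · rcases hz with hz | hz
        · rw [← hz, h4, abs_one]
        · rw [← abs_neg, ← map_neg, ← hz, h4, abs_one]
      · exact h3.2 g hg

theorem exists_dual_abs_eq_one_of_finset (hT : IsPhaseIsometry T)
    (hsurj : Function.Surjective T) (t : K)
    (F : Finset {f : Metric.sphere (0 : C(K, ℝ)) 1 // (f : C(K, ℝ)) t = 1}) :
    ∃ ψ : StrongDual ℝ Y, ‖ψ‖ ≤ 1 ∧ ∀ f ∈ F, |ψ (T f.1)| = 1 := by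
  obtain rfl | ⟨f₀, -⟩ := F.eq_empty_or_nonempty
  · exact ⟨0, by simp, by simp⟩
  obtain ⟨p, -, hp⟩ := exists_sphere_forall_apply_eq f₀.1 f₀.2 F
  obtain ⟨y, hy⟩ := exists_sphere_forall_dual_abs_eq_one hT hsurj F hp
  obtain ⟨ψ, hψ, hψy⟩ := exists_dual_vector'' ℝ (y : Y)
  exact ⟨ψ, hψ, (hy ψ hψ (by simpa using hψy)).2⟩

theorem exists_dual_abs_eq_one (hT : IsPhaseIsometry T) (hsurj : Function.Surjective T) (t : K) :
    ∃ ψ : StrongDual ℝ Y, ‖ψ‖ ≤ 1 ∧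
      ∀ f : Metric.sphere (0 : C(K, ℝ)) 1, (f : C(K, ℝ)) t = 1 → |ψ (T f)| = 1 := by
  obtain ⟨ψ, hψ, hψT⟩ := (WeakDual.isCompact_closedBall (𝕜 := ℝ)
      (0 : StrongDual ℝ Y) 1).inter_iInter_nonempty
    (fun f : {f : Metric.sphere (0 : C(K, ℝ)) 1 // (f : C(K, ℝ)) t = 1} =>
      {ψ : WeakDual ℝ Y | |ψ (T f.1)| = 1})
    (fun f => isClosed_eq (WeakDual.eval_continuous _).abs continuous_const)
    (fun F => by
      obtain ⟨ψ, hψ, h⟩ := exists_dual_abs_eq_one_of_finset hT hsurj t F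
      exact ⟨StrongDual.toWeakDual ψ, by simpa using hψ, by simpa using h⟩)
  refine ⟨WeakDual.toStrongDual ψ, by simpa using hψ, fun f hf => ?_⟩
  exact Set.mem_iInter.1 hψT ⟨f, hf⟩

theorem exists_dual_abs_eq (hT : IsPhaseIsometry T) (hsurj : Function.Surjective T) (t : K) :
    ∃ ψ : StrongDual ℝ Y, ∀ f, |ψ (T f)| = |(f : C(K, ℝ)) t| := by
  obtain ⟨ψ, hψ, h⟩ := exists_dual_abs_eq_one hT hsurj t
  refine ⟨ψ, fun f => le_antisymm ?_ ?_⟩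
  · obtain ⟨g, hgt, hadd, hsub⟩ := exists_apply_eq_one_norm_add_le_norm_sub_le f t
    have hTadd : ‖(T f : Y) + T g‖ ≤ 1 + |(f : C(K, ℝ)) t| := by
      rcases hT.norm_eq_or f g with h' | h' <;> rw [h'.1] <;> assumption
    have hTsub : ‖(T f : Y) - T g‖ ≤ 1 + |(f : C(K, ℝ)) t| := by
      rcases hT.norm_eq_or f g with h' | h' <;> rw [h'.2] <;> assumption
    have h1 := abs_le.1 ((abs_le_norm_of_norm_le_one hψ _).trans hTadd)
    have h2 := abs_le.1 ((abs_le_norm_of_norm_le_one hψ _).trans hTsub)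
    rw [map_add] at h1
    rw [map_sub] at h2
    rw [abs_le]
    rcases eq_or_eq_neg_of_abs_eq (h g hgt) with hg | hg <;> rw [hg] at h1 h2 <;>
      constructor <;> linarith
  · obtain ⟨g, hgt, hor⟩ := exists_apply_eq_one_norm_sub_le_or_norm_add_le f t
    have hTor : ‖(T f : Y) - T g‖ ≤ 1 - |(f : C(K, ℝ)) t| ∨
        ‖(T f : Y) + T g‖ ≤ 1 - |(f : C(K, ℝ)) t| := by
      rcases hT.norm_eq_or f g with h' | h' <;> rw [h'.1, h'.2]
      exacts [hor, hor.symm]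
    have hg := h g hgt
    rcases hTor with h' | h'
    · have h1 := (abs_le_norm_of_norm_le_one hψ _).trans h'
      have h2 := abs_sub_abs_le_abs_sub (ψ (T g)) (ψ (T f))
      rw [map_sub, abs_sub_comm] at h1
      linarith
    · have h1 := (abs_le_norm_of_norm_le_one hψ _).trans h'
      have h2 := abs_sub_abs_le_abs_sub (ψ (T g)) (-ψ (T f))
      rw [abs_neg, sub_neg_eq_add, add_comm (ψ (T g))] at h2
      rw [map_add] at h1
      linarith

/-! ### The linear isometry into `C(K)` -/

theorem exists_eq_norm_smul (hsurj : Function.Surjective T) [Nonempty K] (y : Y) :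
    ∃ f, y = ‖y‖ • (T f : Y) := by
  rcases eq_or_ne y 0 with rfl | hy
  · exact ⟨⟨1, by simp⟩, by simp⟩
  · obtain ⟨f, hf⟩ := hsurj ⟨‖y‖⁻¹ • y, by simp [norm_smul, hy]⟩
    exact ⟨f, by rw [hf, smul_inv_smul₀ (norm_ne_zero_iff.2 hy)]⟩

theorem exists_linearIsometry (hT : IsPhaseIsometry T) (hsurj : Function.Surjective T)
    [Nonempty K] {e : Metric.sphere (0 : C(K, ℝ)) 1} (he : (e : C(K, ℝ)) = 1) :
    ∃ Φ : Y →ₗᵢ[ℝ] C(K, ℝ), Φ (T e) = 1 ∧ ∀ f x, |Φ (T f) x| = |(f : C(K, ℝ)) x| := by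
  have hex : ∀ t, ∃ ψ : StrongDual ℝ Y, ψ (T e) = 1 ∧ ∀ f, |ψ (T f)| = |(f : C(K, ℝ)) t| := by
    intro t
    obtain ⟨ψ, hψ⟩ := exists_dual_abs_eq hT hsurj t
    have h1 : |ψ (T e)| = 1 := by rw [hψ, he]; simp
    rcases eq_or_eq_neg_of_abs_eq h1 with h | h
    · exact ⟨ψ, h, hψ⟩
    · exact ⟨-ψ, by simp [h], fun f => by rw [← hψ f]; simp⟩
  choose φ hφe hφ using hex
  have hφy : ∀ y, ∃ f : Metric.sphere (0 : C(K, ℝ)) 1,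
      ∀ t, |φ t y| = ‖y‖ * |(f : C(K, ℝ)) t| := fun y => by
    obtain ⟨f, hf⟩ := exists_eq_norm_smul hsurj y
    refine ⟨f, fun t => ?_⟩
    rw [← hφ t f]
    conv_lhs => rw [hf, map_smul, smul_eq_mul, abs_mul, abs_norm]
  have hle : ∀ t y, |φ t y| ≤ ‖y‖ := fun t y => by
    obtain ⟨f, hf⟩ := hφy y
    rw [hf]
    exact mul_le_of_le_one_right (norm_nonneg y) (abs_coe_sphere_apply_le_one f t)
  have habs : ∀ y, Continuous fun t => |φ t y| := fun y => by
    obtain ⟨f, hf⟩ := hφy y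
    simp only [hf]
    fun_prop
  have hcont : ∀ y, Continuous fun t => φ t y := fun y => by
    -- The shift by `‖y‖ • T e` makes the function nonnegative, hence equal to its modulus.
    have : (fun t => φ t y) = fun t => |φ t (y + ‖y‖ • (T e : Y))| - ‖y‖ := by
      funext t
      have h1 : φ t (y + ‖y‖ • (T e : Y)) = φ t y + ‖y‖ := by simp [hφe]
      rw [h1, abs_of_nonneg (by linarith [(abs_le.1 (hle t y)).1])]
      ring
    rw [this]
    exact (habs _).sub continuous_const
  let L : Y →ₗ[ℝ] C(K, ℝ) :=
    { toFun := fun y => ⟨fun t => φ t y, hcont y⟩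
      map_add' := fun y z => by ext t; simp
      map_smul' := fun c y => by ext t; simp }
  have hL : ∀ y t, L y t = φ t y := fun _ _ => rfl
  refine ⟨⟨L, fun y => le_antisymm ?_ ?_⟩, ?_, fun f x => hφ x f⟩
  · exact (ContinuousMap.norm_le _ (norm_nonneg y)).2 fun t => hle t y
  · obtain ⟨f, hf⟩ := hφy y
    obtain ⟨s, hs⟩ := (f : C(K, ℝ)).exists_abs_apply_eq_norm
    have := (L y).norm_coe_le_norm s
    rwa [Real.norm_eq_abs, hL, hf, hs, norm_eq_of_mem_sphere f, mul_one] at this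
  · ext t
    exact hφe t

/-- If `Φ (T g)` took both signs, then `‖T 1 + T g‖` and `‖T 1 - T g‖` would both exceed `1`, but
`‖1 - g‖ ≤ 1`. -/
theorem map_eq_or_eq_neg_of_nonneg (hT : IsPhaseIsometry T)
    {e : Metric.sphere (0 : C(K, ℝ)) 1} (he : (e : C(K, ℝ)) = 1) {Φ : Y →ₗᵢ[ℝ] C(K, ℝ)}
    (hΦe : Φ (T e) = 1) (hΦ : ∀ f x, |Φ (T f) x| = |(f : C(K, ℝ)) x|)
    (g : Metric.sphere (0 : C(K, ℝ)) 1) (hg : 0 ≤ (g : C(K, ℝ))) :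
    Φ (T g) = g ∨ Φ (T g) = -g := by
  by_contra hne
  rw [not_or, ContinuousMap.ext_iff, ContinuousMap.ext_iff, not_forall, not_forall] at hne
  obtain ⟨⟨t, ht⟩, s, hs⟩ := hne
  have ht' : Φ (T g) t = -(g : C(K, ℝ)) t := (abs_eq_abs.1 (hΦ g t)).resolve_left ht
  have hs' : Φ (T g) s = (g : C(K, ℝ)) s := (abs_eq_abs.1 (hΦ g s)).resolve_right hs
  have hgt : 0 < (g : C(K, ℝ)) t :=
    lt_of_le_of_ne (hg t) fun h0 => ht (by rw [ht', ← h0]; simp)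
  have hgs : 0 < (g : C(K, ℝ)) s :=
    lt_of_le_of_ne (hg s) fun h0 => hs (by rw [hs', ContinuousMap.neg_apply, ← h0]; simp)
  have h1 : ‖(e : C(K, ℝ)) - g‖ ≤ 1 := (ContinuousMap.norm_le _ zero_le_one).2 fun x => by
    have h2 := (abs_le.1 (abs_coe_sphere_apply_le_one g x)).2
    have h3 : 0 ≤ (g : C(K, ℝ)) x := hg x
    rw [he, ContinuousMap.sub_apply, ContinuousMap.one_apply, Real.norm_eq_abs, abs_le]
    constructor <;> linarith
  have hadd := (Φ ((T e : Y) + T g)).apply_le_norm s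
  have hsub := (Φ ((T e : Y) - T g)).apply_le_norm t
  rw [Φ.norm_map, map_add, ContinuousMap.add_apply, hΦe, hs', ContinuousMap.one_apply] at hadd
  rw [Φ.norm_map, map_sub, ContinuousMap.sub_apply, hΦe, ht', ContinuousMap.one_apply] at hsub
  rcases hT.norm_eq_or e g with h | h
  · linarith [h.2]
  · linarith [h.1]

theorem map_eq_or_eq_neg (hT : IsPhaseIsometry T)
    {e : Metric.sphere (0 : C(K, ℝ)) 1} (he : (e : C(K, ℝ)) = 1) {Φ : Y →ₗᵢ[ℝ] C(K, ℝ)}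
    (hΦe : Φ (T e) = 1) (hΦ : ∀ f x, |Φ (T f) x| = |(f : C(K, ℝ)) x|)
    (f : Metric.sphere (0 : C(K, ℝ)) 1) :
    Φ (T f) = f ∨ Φ (T f) = -f := by
  refine eq_or_eq_neg_of_forall_nonneg (norm_eq_of_mem_sphere f) (hΦ f) fun g hg hg1 => ?_
  have h := hT.norm_eq_or f ⟨g, mem_sphere_zero_iff_norm.2 hg1⟩
  rw [← Φ.norm_map, ← Φ.norm_map (_ - _), map_add, map_sub] at h
  rcases map_eq_or_eq_neg_of_nonneg hT he hΦe hΦ ⟨g, mem_sphere_zero_iff_norm.2 hg1⟩ hg with h' | h'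
  · rwa [h'] at h
  · rw [h', ← sub_eq_add_neg, sub_neg_eq_add] at h
    exact h.symm.imp And.symm And.symm

/-- When `K` is empty both spheres are empty, so `Y` is trivial and the zero map serves. -/
theorem exists_linearIsometry_map_eq_or_eq_neg (hT : IsPhaseIsometry T)
    (hsurj : Function.Surjective T) :
    ∃ Φ : Y →ₗᵢ[ℝ] C(K, ℝ), ∀ f, Φ (T f) = f ∨ Φ (T f) = -f := by
  rcases isEmpty_or_nonempty K with hK | hK
  · have hY : ∀ y : Y, y = 0 := fun y => by
      by_contra hy
      obtain ⟨f, -⟩ := hsurj ⟨‖y‖⁻¹ • y, by simp [norm_smul, hy]⟩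
      have := norm_eq_of_mem_sphere f
      rw [Subsingleton.elim (f : C(K, ℝ)) 0, norm_zero] at this
      exact zero_ne_one this
    exact ⟨⟨0, fun y => by simp [hY y]⟩, fun f => Or.inl (Subsingleton.elim _ _)⟩
  · obtain ⟨Φ, hΦe, hΦ⟩ := exists_linearIsometry hT hsurj (e := ⟨1, by simp⟩) rfl
    exact ⟨Φ, map_eq_or_eq_neg hT rfl hΦe hΦ⟩

end Functionals

theorem theorem2 {K Y : Type*} [TopologicalSpace K] [CompactSpace K] [T2Space K]
    [NormedAddCommGroup Y] [NormedSpace ℝ Y] [CompleteSpace Y]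
    (T : Metric.sphere (0 : C(K, ℝ)) 1 → Metric.sphere (0 : Y) 1)
    (hT : IsPhaseIsometry T) (hsurj : Function.Surjective T) :
    ∃ S : Metric.sphere (0 : C(K, ℝ)) 1 → Metric.sphere (0 : Y) 1,
      PhaseEquivalent S T ∧ Isometry S ∧
        ∃ U : C(K, ℝ) ≃ₗᵢ[ℝ] Y, ∀ f : Metric.sphere (0 : C(K, ℝ)) 1,
          U (f : C(K, ℝ)) = (S f : Y) := by
  classical
  obtain ⟨Φ, hΦ⟩ := exists_linearIsometry_map_eq_or_eq_neg hT hsurj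
  have hΦsurj : Function.Surjective Φ := fun f => by
    rcases eq_or_ne f 0 with rfl | hf
    · exact ⟨0, map_zero Φ⟩
    have hn : ‖f‖ ≠ 0 := norm_ne_zero_iff.2 hf
    rcases hΦ ⟨‖f‖⁻¹ • f, by simp [norm_smul, hf]⟩ with h | h
    · exact ⟨‖f‖ • (T _ : Y), by rw [map_smul, h, smul_inv_smul₀ hn]⟩
    · exact ⟨-(‖f‖ • (T _ : Y)), by rw [map_neg, map_smul, h, smul_neg, neg_neg,
        smul_inv_smul₀ hn]⟩
  let E : Y ≃ₗᵢ[ℝ] C(K, ℝ) := LinearIsometryEquiv.ofSurjective Φ hΦsurj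
  have hE : ∀ y, E y = Φ y := fun _ => rfl
  refine ⟨fun f => ⟨E.symm f, mem_sphere_zero_iff_norm.2
    (by rw [E.symm.norm_map, norm_eq_of_mem_sphere f])⟩, ?_, ?_, E.symm, fun f => rfl⟩
  · refine ⟨fun f => if Φ (T f) = f then 1 else -1, fun f => ?_, fun f => ?_⟩
    · dsimp only; split_ifs <;> simp
    · apply E.injective
      dsimp only
      rw [LinearIsometryEquiv.apply_symm_apply, map_smul, hE]
      split_ifs with h
      · rw [one_smul, h]
      · rw [(hΦ f).resolve_left h, neg_smul, one_smul, neg_neg]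
  · exact Isometry.of_dist_eq fun f g => E.symm.dist_map f g
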